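/- Let $\mathcal M$ be one of the space forms $\mathbb R^3$, $\mathbb S^3$ (curvature $1$) or $\mathbb H^3$ (curvature $-1$), let $I\subset\mathbb R$ be a nonempty open interval, and let $\gamma:I\to\mathcal M$ be a simple smooth curve parametrised by arc length (injective on $I$, or a simple closed curve parametrised periodically on $I=\mathbb R$). Suppose that $\gamma$ has a smooth orthonormal frame $\{T=\dot\gamma,N,B\}$ satisfying the Frenet equations $$\frac{DT}{ds}=k_1N,\qquad \frac{DN}{ds}=-k_1T+k_2B,\qquad \frac{DB}{ds}=-k_2N$$ with constant $k_1,k_2$. Let $\rho_0>0$, and let the tube of radius $\rho_0$ about $\gamma$ be parametrised by $$\beta(s,\psi)=\exp_{\gamma(s)}\big(\rho_0\cos\psi\,N(s)+\rho_0\sin\psi\,B(s)\big),\qquad s\in I,\ \psi\in\mathbb R/2\pi\mathbb Z .$$ Assume that the tube is a well-defined surface: $\beta$ is an immersion, and each point of the tube is $\exp_{\gamma(s)}(\nu)$ for only one point $\gamma(s)$ of the curve and only one vector $\nu\perp\dot\gamma(s)$ of length $\rho_0$ at it. Then: 1. The coefficients of the line element induced on the tube, in the coordinates $(s,\psi)$,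 do not depend on $s$. 2. The momentum $p_s$ conjugate to $s$ is a well-defined smooth function on the cotangent bundle of the tube, linear in the momenta, and is a first integral of the geodesic flow of the tube, i.e. of the Hamiltonian flow of $H=\tfrac12 g^{ij}p_ip_j$, where $g$ is the induced metric. 3. The geodesic flow on the tube is Liouville integrable: $H$ is smooth on the cotangent bundle of the tube, and there are two smooth first integrals on it that are in involution and functionally independent (their differentials are linearly independent on a dense set). -/

import Mathlib

open scoped ContDiff

noncomputable section

/-! ### The three space forms -/

/-- The complete simply connected three-dimensional space forms of curvature `0`, `1`, `-1`. -/
inductive SpaceForm where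
  | euclidean
  | spherical
  | hyperbolic

namespace SpaceForm

/-- Dimension of the vector space in which the model lives. -/
abbrev ambientDim : SpaceForm → ℕ
  | euclidean => 3
  | spherical => 4
  | hyperbolic => 4

/-- The ambient vector space: `ℝ³` for Euclidean space, `ℝ⁴` for the unit sphere and for the
hyperboloid.  Its Euclidean norm is only used for its topology. -/
abbrev Ambient (M : SpaceForm) : Type := EuclideanSpace ℝ (Fin M.ambientDim)

/-- The Minkowski product `x₁y₁ + x₂y₂ + x₃y₃ - x₀y₀` on `ℝ⁴`. -/
def minkowski (x y : EuclideanSpace ℝ (Fin 4)) : ℝ :=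
  ∑ i : Fin 3, x i.succ * y i.succ - x 0 * y 0

/-- The ambient scalar product whose restriction to tangent vectors is the Riemannian metric. -/
def metric : (M : SpaceForm) → M.Ambient → M.Ambient → ℝ
  | euclidean, x, y => inner ℝ x y
  | spherical, x, y => inner ℝ x y
  | hyperbolic, x, y => minkowski x y

/-- The points of the space form: all of `ℝ³`, the unit sphere of `ℝ⁴`, or the upper sheet of the
hyperboloid in Minkowski space. -/
def carrier : (M : SpaceForm) → Set M.Ambient
  | euclidean => Set.univ
  | spherical => Metric.sphere 0 1
  | hyperbolic => {x | minkowski x x = -1 ∧ 0 < (x : EuclideanSpace ℝ (Fin 4)) 0}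

variable (M : SpaceForm)

/-- The tangent space at `x`, as the set of velocities at `x` of smooth curves in the space form. -/
def tangent (x : M.Ambient) : Set M.Ambient :=
  {v | ∃ c : ℝ → M.Ambient, ContDiff ℝ ∞ c ∧ (∀ t, c t ∈ M.carrier) ∧ c 0 = x ∧ deriv c 0 = v}

/-- `W` is the Levi-Civita covariant derivative `DV/ds` at `s` of the field `V` along the curve
`γ`: the tangential component of the ambient derivative of `V`. -/
def HasCovDeriv (γ V : ℝ → M.Ambient) (W : M.Ambient) (s : ℝ) : Prop :=
  W ∈ M.tangent (γ s) ∧ ∀ u ∈ M.tangent (γ s), M.metric (deriv V s - W) u = 0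

/-- Complete geodesics: smooth curves in the space form whose velocity is parallel. -/
def IsGeodesic (Γ : ℝ → M.Ambient) : Prop :=
  ContDiff ℝ ∞ Γ ∧ (∀ t, Γ t ∈ M.carrier) ∧ ∀ t, M.HasCovDeriv Γ (deriv Γ) 0 t

/-- The exponential map: `exp x v = Γ 1` for the geodesic `Γ` through `x` with initial
velocity `v`. -/
def exp (x v : M.Ambient) : M.Ambient :=
  Classical.epsilon fun y =>
    ∃ Γ : ℝ → M.Ambient, M.IsGeodesic Γ ∧ Γ 0 = x ∧ deriv Γ 0 = v ∧ Γ 1 = y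

/-! ### Curves with Frenet frame, and tubes -/

/-- `γ`, defined on `I`, is a smooth curve in `M` parametrised by arc length, and
`(T, N, B)` with `T = γ'` is a smooth orthonormal frame of `M` along `γ` that satisfies the Frenet
equations with curvature scalars `k₁`, `k₂`. -/
structure IsFrenetCurve (I : Set ℝ) (γ N B : ℝ → M.Ambient) (k₁ k₂ : ℝ → ℝ) : Prop where
  smooth : ContDiffOn ℝ ∞ γ I
  smooth_N : ContDiffOn ℝ ∞ N I
  smooth_B : ContDiffOn ℝ ∞ B I
  mem : ∀ s ∈ I, γ s ∈ M.carrier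
  tangent_N : ∀ s ∈ I, N s ∈ M.tangent (γ s)
  tangent_B : ∀ s ∈ I, B s ∈ M.tangent (γ s)
  unit_T : ∀ s ∈ I, M.metric (deriv γ s) (deriv γ s) = 1
  unit_N : ∀ s ∈ I, M.metric (N s) (N s) = 1
  unit_B : ∀ s ∈ I, M.metric (B s) (B s) = 1
  orth_TN : ∀ s ∈ I, M.metric (deriv γ s) (N s) = 0
  orth_TB : ∀ s ∈ I, M.metric (deriv γ s) (B s) = 0
  orth_NB : ∀ s ∈ I, M.metric (N s) (B s) = 0
  frenet_T : ∀ s ∈ I, M.HasCovDeriv γ (deriv γ) (k₁ s • N s) s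
  frenet_N : ∀ s ∈ I, M.HasCovDeriv γ N (-k₁ s • deriv γ s + k₂ s • B s) s
  frenet_B : ∀ s ∈ I, M.HasCovDeriv γ B (-k₂ s • N s) s

/-- A simple curve: either injective on its parameter interval, or a simple closed curve, which is
then parametrised periodically by the whole line and injective modulo its period. -/
def IsSimpleCurve (I : Set ℝ) (γ : ℝ → M.Ambient) : Prop :=
  Set.InjOn γ I ∨
    (I = Set.univ ∧ ∃ L : ℝ, 0 < L ∧ ∀ s t : ℝ, γ s = γ t ↔ ∃ m : ℤ, t = s + m * L)

/-- The normal vector `ρ cos ψ N(s) + ρ sin ψ B(s)`, where `q = (s, ψ)`. -/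
def normalVector (N B : ℝ → M.Ambient) (ρ : ℝ) (q : Fin 2 → ℝ) : M.Ambient :=
  (ρ * Real.cos (q 1)) • N (q 0) + (ρ * Real.sin (q 1)) • B (q 0)

/-- The parametrisation `β(s, ψ) = exp_{γ(s)} (ρ cos ψ N(s) + ρ sin ψ B(s))` of the tube of
radius `ρ` about `γ`, where `q = (s, ψ)`. -/
def tube (γ N B : ℝ → M.Ambient) (ρ : ℝ) (q : Fin 2 → ℝ) : M.Ambient :=
  M.exp (γ (q 0)) (M.normalVector N B ρ q)

end SpaceForm

/-- The parameter domain `I × ℝ` of the tube; the angle `ψ` ranges over the line, and the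
tube map has period `2π` in it. -/
def tubeDomain (I : Set ℝ) : Set (Fin 2 → ℝ) := {q | q 0 ∈ I}

/-- The coordinate tangent vector `∂β/∂qᵢ`. -/
def coordVector {n : ℕ} {E : Type*} [NormedAddCommGroup E] [NormedSpace ℝ E]
    (β : (Fin n → ℝ) → E) (i : Fin n) (q : Fin n → ℝ) : E :=
  fderiv ℝ β q (Pi.single i 1)

namespace SpaceForm

variable (M : SpaceForm)

/-- The tube of radius `ρ` is a well-defined surface: its parametrisation is an immersion (no focal
points), and the tube does not meet itself, that is, a point of the tube comes from only one
normal vector at only one point of the curve. -/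
def IsWellDefinedTube (I : Set ℝ) (γ N B : ℝ → M.Ambient) (ρ : ℝ) : Prop :=
  (∀ q ∈ tubeDomain I, LinearIndependent ℝ fun i => coordVector (M.tube γ N B ρ) i q) ∧
  ∀ q ∈ tubeDomain I, ∀ q' ∈ tubeDomain I, M.tube γ N B ρ q = M.tube γ N B ρ q' →
    γ (q 0) = γ (q' 0) ∧ M.normalVector N B ρ q = M.normalVector N B ρ q'

end SpaceForm

/-! ### Hamiltonian systems and geodesic flows of parametrised submanifolds -/

/-- Canonical coordinates `(q, p)` on a cotangent bundle. -/
abbrev Phase (n : ℕ) : Type := (Fin n → ℝ) × (Fin n → ℝ)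

/-- The part of phase space over the parameter domain `U`. -/
def phaseDomain {n : ℕ} (U : Set (Fin n → ℝ)) : Set (Phase n) := {z | z.1 ∈ U}

/-- `∂f/∂qᵢ`. -/
def derivQ {n : ℕ} (f : Phase n → ℝ) (i : Fin n) (z : Phase n) : ℝ :=
  fderiv ℝ f z (Pi.single i 1, 0)

/-- `∂f/∂pᵢ`. -/
def derivP {n : ℕ} (f : Phase n → ℝ) (i : Fin n) (z : Phase n) : ℝ :=
  fderiv ℝ f z (0, Pi.single i 1)

/-- The canonical Poisson bracket. -/
def poisson {n : ℕ} (f g : Phase n → ℝ) (z : Phase n) : ℝ :=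
  ∑ i, (derivQ f i z * derivP g i z - derivP f i z * derivQ g i z)

/-- The Hamiltonian vector field of `H`. -/
def hamiltonianField {n : ℕ} (H : Phase n → ℝ) (z : Phase n) : Phase n :=
  (fun i => derivP H i z, fun i => -derivQ H i z)

/-- `F` is a first integral: it is constant along every solution of Hamilton's equations for `H`
over `U`. -/
def IsFirstIntegral {n : ℕ} (U : Set (Fin n → ℝ)) (H F : Phase n → ℝ) : Prop :=
  ∀ J : Set ℝ, IsOpen J → IsPreconnected J → ∀ z : ℝ → Phase n,
    (∀ t ∈ J, z t ∈ phaseDomain U ∧ HasDerivAt z (hamiltonianField H (z t)) t) →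
    ∀ t ∈ J, ∀ t' ∈ J, F (z t) = F (z t')

/-- The functions `Fᵢ` are functionally independent over `U`: their differentials are linearly
independent on a dense part of phase space. -/
def FunctionallyIndependent {n k : ℕ} (U : Set (Fin n → ℝ)) (F : Fin k → Phase n → ℝ) : Prop :=
  phaseDomain U ⊆
    closure {z | z ∈ phaseDomain U ∧ LinearIndependent ℝ fun i => fderiv ℝ (F i) z}

/-- `(q, p)` and `(q', p')` are coordinates of the same covector on the submanifold
parametrised by `β`: the points agree, and `p`, `p'` are the components, in the two coordinate
frames, of one linear functional on the tangent space. -/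
def SameCovector {n : ℕ} {E : Type*} [NormedAddCommGroup E] [NormedSpace ℝ E]
    (β : (Fin n → ℝ) → E) (z z' : Phase n) : Prop :=
  β z.1 = β z'.1 ∧ ∃ ξ : E →ₗ[ℝ] ℝ,
    (∀ i, z.2 i = ξ (coordVector β i z.1)) ∧ ∀ i, z'.2 i = ξ (coordVector β i z'.1)

/-- `F` is a smooth function on the cotangent bundle of the submanifold parametrised by `β` over
`U`: it is smooth in canonical coordinates, and takes the same value at coordinates of the same
covector. -/
def IsSmoothPhaseFunction {n : ℕ} {E : Type*} [NormedAddCommGroup E] [NormedSpace ℝ E]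
    (β : (Fin n → ℝ) → E) (U : Set (Fin n → ℝ)) (F : Phase n → ℝ) : Prop :=
  ContDiffOn ℝ ∞ F (phaseDomain U) ∧
  ∀ z ∈ phaseDomain U, ∀ z' ∈ phaseDomain U, SameCovector β z z' → F z = F z'

/-- Liouville integrability, over `U`, of the Hamiltonian system `H` on the cotangent bundle of the
`n`-dimensional submanifold parametrised by `β`: there are `n` smooth first integrals that are
functionally independent and in involution. -/
def IsLiouvilleIntegrable {n : ℕ} {E : Type*} [NormedAddCommGroup E] [NormedSpace ℝ E]
    (β : (Fin n → ℝ) → E) (U : Set (Fin n → ℝ)) (H : Phase n → ℝ) : Prop :=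
  IsSmoothPhaseFunction β U H ∧
  ∃ F : Fin n → Phase n → ℝ,
    (∀ i, IsSmoothPhaseFunction β U (F i)) ∧
    (∀ i, IsFirstIntegral U H (F i)) ∧
    (∀ i j, ∀ z ∈ phaseDomain U, poisson (F i) (F j) z = 0) ∧
    FunctionallyIndependent U F

namespace SpaceForm

variable (M : SpaceForm)

/-- The coefficients `gᵢⱼ` of the line element induced from `M` on the submanifold parametrised by
`β`. -/
def lineElement {n : ℕ} (β : (Fin n → ℝ) → M.Ambient) (q : Fin n → ℝ) :
    Matrix (Fin n) (Fin n) ℝ :=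
  Matrix.of fun i j => M.metric (coordVector β i q) (coordVector β j q)

/-- The Hamiltonian `½ gⁱʲ pᵢ pⱼ` of the geodesic flow of the induced metric. -/
def geodesicHamiltonian {n : ℕ} (β : (Fin n → ℝ) → M.Ambient) (z : Phase n) : ℝ :=
  1 / 2 * ∑ i, ∑ j, (M.lineElement β z.1)⁻¹ i j * z.2 i * z.2 j

end SpaceForm

end

/-!
The tube is computed in the ambient vector space, treating the three space forms at once through
the curvature `κ` and the generalised sine and cosine `sn`, `cs`. A geodesic of constant squared
speed `c` satisfies the linear equation `Γ'' = -κ c Γ` (`IsGeodesic.hasDerivAt_deriv`), whose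
solution gives `exp x (r u) = cs r x + sn r u` for a unit tangent vector `u` (`exp_smul`).

The fields `N` and `B` are tangent to the space form and orthogonal to the curve, so their covariant
derivatives are their ambient derivatives, and the Frenet equations give
`∂β/∂s = a T + sn ρ k₂ A`, `∂β/∂ψ = sn ρ A`, where `A = cos ψ B - sin ψ N` and
`a = cs ρ - sn ρ k₁ cos ψ`. The line element therefore has determinant `sn² ρ a²`, which the
immersion hypothesis makes nonzero, and for constant `k₁`, `k₂` it does not depend on `s`. So `s` is
cyclic, `{H, p_s} = 0`, and `H`, `p_s` are independent wherever `∂H/∂p_ψ ≠ 0`. On each cotangent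
fibre `∂H/∂p_ψ` is a nonzero linear form, so this is a dense condition.

That `p_s` and `H` are functions on the cotangent bundle is clear for an injective curve. For a
simple closed curve the frame may fail to close up: after a period the normal plane could return
rotated. The coordinate frame still depends on the point of the tube only
(`IsFrenetCurve.coordVector_tube_eq`), because the two frames differ by a rotation
(`IsFrenetCurve.exists_frame_rotation`): if `k₁ ≠ 0` they coincide, since `k₁ N` is determined by
`γ''`, and `B` is then determined by `N'` (when `k₂ ≠ 0`) or is constant; if `k₁ = 0` the frame
rotates at constant rate in a fixed plane of the ambient space.
-/

noncomputable section

namespace SpaceForm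

variable (M : SpaceForm)

/-! ### The ambient scalar product -/

theorem metric_comm (x y : M.Ambient) : M.metric x y = M.metric y x := by
  cases M
  · exact real_inner_comm _ _
  · exact real_inner_comm _ _
  · simp only [metric, minkowski, mul_comm]

theorem metric_add_left (x y z : M.Ambient) :
    M.metric (x + y) z = M.metric x z + M.metric y z := by
  cases M
  · exact inner_add_left _ _ _
  · exact inner_add_left _ _ _
  · simp only [metric, minkowski, PiLp.add_apply, add_mul, Finset.sum_add_distrib]
    ring

theorem metric_smul_left (a : ℝ) (x y : M.Ambient) : M.metric (a • x) y = a * M.metric x y := by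
  cases M
  · exact real_inner_smul_left _ _ _
  · exact real_inner_smul_left _ _ _
  · simp only [metric, minkowski, PiLp.smul_apply, smul_eq_mul, mul_sub, Finset.mul_sum, mul_assoc]

theorem metric_add_right (x y z : M.Ambient) :
    M.metric x (y + z) = M.metric x y + M.metric x z := by
  rw [metric_comm, metric_add_left, metric_comm M y, metric_comm M z]

theorem metric_smul_right (a : ℝ) (x y : M.Ambient) : M.metric x (a • y) = a * M.metric x y := by
  rw [metric_comm, metric_smul_left, metric_comm M y]

theorem metric_neg_left (x y : M.Ambient) : M.metric (-x) y = -M.metric x y := by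
  rw [← neg_one_smul ℝ x, metric_smul_left, neg_one_mul]

theorem metric_sub_left (x y z : M.Ambient) :
    M.metric (x - y) z = M.metric x z - M.metric y z := by
  rw [sub_eq_add_neg, metric_add_left, metric_neg_left, sub_eq_add_neg]

theorem metric_sub_right (x y z : M.Ambient) :
    M.metric x (y - z) = M.metric x y - M.metric x z := by
  rw [metric_comm, metric_sub_left, metric_comm M y, metric_comm M z]

theorem metric_zero_right (x : M.Ambient) : M.metric x 0 = 0 := by
  simpa using M.metric_smul_right 0 x 0

theorem eq_zero_of_metric_eq_zero {x : M.Ambient} (h : ∀ y, M.metric x y = 0) : x = 0 := by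
  cases M
  · exact inner_self_eq_zero.1 (h x)
  · exact inner_self_eq_zero.1 (h x)
  · have h' : ∀ y : EuclideanSpace ℝ (Fin 4), minkowski x y = 0 := h
    have key : ∀ i : Fin 4, (x : EuclideanSpace ℝ (Fin 4)) i = 0 := by
      intro i
      have := h' (EuclideanSpace.single i 1)
      refine Fin.cases (fun this => ?_) (fun j this => ?_) i this
      · simpa [minkowski, PiLp.single_apply, (Fin.succ_ne_zero _)] using this
      · simpa [minkowski, PiLp.single_apply, (Fin.succ_ne_zero _).symm] using this
    exact PiLp.ext key

theorem _root_.HasDerivAt.spaceFormMetric {f g : ℝ → M.Ambient} {f' g' : M.Ambient} {t : ℝ}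
    (hf : HasDerivAt f f' t) (hg : HasDerivAt g g' t) :
    HasDerivAt (fun s => M.metric (f s) (g s)) (M.metric (f t) g' + M.metric f' (g t)) t := by
  cases M
  · exact hf.inner ℝ hg
  · exact hf.inner ℝ hg
  · have hc : ∀ {k : ℝ → EuclideanSpace ℝ (Fin 4)} {k'} (i : Fin 4), HasDerivAt k k' t →
        HasDerivAt (fun s => k s i) (k' i) t := fun i hk =>
      (EuclideanSpace.proj (𝕜 := ℝ) i).hasFDerivAt.comp_hasDerivAt t hk
    refine ((HasDerivAt.fun_sum fun (i : Fin 3) _ => (hc i.succ hf).mul (hc i.succ hg)).sub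
      ((hc 0 hf).mul (hc 0 hg))).congr_deriv ?_
    simp only [metric, minkowski, Fin.sum_univ_three]
    ring

/-! ### Tangent vectors -/

/-- The sectional curvature of the space form. -/
def curvature : SpaceForm → ℝ
  | euclidean => 0
  | spherical => 1
  | hyperbolic => -1

theorem curvature_pow_three : M.curvature ^ 3 = M.curvature := by
  cases M <;> norm_num [curvature]

/-- The curvature factor makes the quadric equation `⟨x, x⟩ = κ` of the two curved models hold
vacuously in Euclidean space. -/
theorem curvature_mul_metric_self {x : M.Ambient} (hx : x ∈ M.carrier) :
    M.curvature * M.metric x x = M.curvature ^ 2 := by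
  cases M
  · simp [curvature]
  · have h : ‖x‖ = 1 := by simpa [carrier] using hx
    have : spherical.metric x x = 1 := by
      change inner ℝ x x = 1
      rw [real_inner_self_eq_norm_sq, h, one_pow]
    simp [curvature, this]
  · have : hyperbolic.metric x x = -1 := hx.1
    simp [curvature, this]

theorem curvature_mul_metric_eq_zero {x v : M.Ambient} (hv : v ∈ M.tangent x) :
    M.curvature * M.metric x v = 0 := by
  obtain ⟨c, hc, hmem, rfl, rfl⟩ := hv
  have h := (hc.differentiable (by simp)).differentiableAt.hasDerivAt (x := 0)
  have h1 := (h.spaceFormMetric M h).const_mul M.curvature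
  have h2 : (fun t => M.curvature * M.metric (c t) (c t)) = fun _ => M.curvature ^ 2 :=
    funext fun t => M.curvature_mul_metric_self (hmem t)
  rw [h2] at h1
  have h3 := h1.unique (hasDerivAt_const _ _)
  rw [M.metric_comm (deriv c 0)] at h3
  linarith

/-- Reversed Cauchy-Schwarz inequality: a vector orthogonal to a point of the hyperboloid is
dominated by its own Minkowski square. -/
theorem minkowski_sq_le {x v : EuclideanSpace ℝ (Fin 4)} (hx : minkowski x x = -1)
    (hv : minkowski x v = 0) : v 0 ^ 2 ≤ (x 0 ^ 2 - 1) * minkowski v v := by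
  simp only [minkowski, Fin.sum_univ_three] at *
  have e1 : x (Fin.succ 0) * v (Fin.succ 0) + x (Fin.succ 1) * v (Fin.succ 1)
    + x (Fin.succ 2) * v (Fin.succ 2) = x 0 * v 0 := by linarith
  have e2 : x 0 ^ 2 - 1 = x (Fin.succ 0) ^ 2 + x (Fin.succ 1) ^ 2 + x (Fin.succ 2) ^ 2 := by
    linarith
  generalize x (Fin.succ 0) = x1 at *
  generalize x (Fin.succ 1) = x2 at *
  generalize x (Fin.succ 2) = x3 at *
  generalize v (Fin.succ 0) = v1 at *
  generalize v (Fin.succ 1) = v2 at *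
  generalize v (Fin.succ 2) = v3 at *
  have cs : (x1 * v1 + x2 * v2 + x3 * v3) ^ 2 ≤
      (x1 ^ 2 + x2 ^ 2 + x3 ^ 2) * (v1 ^ 2 + v2 ^ 2 + v3 ^ 2) := by
    nlinarith [sq_nonneg (x1 * v2 - x2 * v1), sq_nonneg (x1 * v3 - x3 * v1),
      sq_nonneg (x2 * v3 - x3 * v2)]
  rw [e1, ← e2] at cs
  linarith

theorem metric_self_pos {x v : M.Ambient} (hx : x ∈ M.carrier)
    (hv : M.curvature * M.metric x v = 0) (hv0 : v ≠ 0) : 0 < M.metric v v := by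
  cases M
  · exact real_inner_self_pos.2 hv0
  · exact real_inner_self_pos.2 hv0
  · have hxx : minkowski x x = -1 := hx.1
    have hxv : minkowski x v = 0 := by simpa [curvature, metric] using hv
    have h := minkowski_sq_le hxx hxv
    change 0 < minkowski v v
    by_contra! hle
    have hx0 : 0 ≤ (x : EuclideanSpace ℝ (Fin 4)) 0 ^ 2 - 1 := by
      have : 0 ≤ ∑ i : Fin 3, x i.succ * x i.succ := Finset.sum_nonneg fun i _ => mul_self_nonneg _
      simp only [minkowski] at hxx
      linarith
    have hv00 : (v : EuclideanSpace ℝ (Fin 4)) 0 = 0 :=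
      pow_eq_zero_iff two_ne_zero |>.1 <| le_antisymm
        (h.trans (mul_nonpos_of_nonneg_of_nonpos hx0 hle)) (sq_nonneg _)
    have hsum : ∑ i : Fin 3, v i.succ * v i.succ = 0 := le_antisymm
      (by simpa [minkowski, hv00] using hle) (Finset.sum_nonneg fun i _ => mul_self_nonneg _)
    rw [Finset.sum_eq_zero_iff_of_nonneg fun i _ => mul_self_nonneg _] at hsum
    exact hv0 <| PiLp.ext <| Fin.cases hv00 fun j => mul_self_eq_zero.1 (hsum j (Finset.mem_univ j))

/-! ### Geodesics -/

/-- The generalised cosine: the solution of `f'' = -κ f` with `f 0 = 1`, `f' 0 = 0`. -/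
def cs : SpaceForm → ℝ → ℝ
  | euclidean, _ => 1
  | spherical, t => Real.cos t
  | hyperbolic, t => Real.cosh t

/-- The generalised sine: the solution of `f'' = -κ f` with `f 0 = 0`, `f' 0 = 1`. -/
def sn : SpaceForm → ℝ → ℝ
  | euclidean, t => t
  | spherical, t => Real.sin t
  | hyperbolic, t => Real.sinh t

theorem cs_zero : M.cs 0 = 1 := by cases M <;> simp [cs]

theorem sn_zero : M.sn 0 = 0 := by cases M <;> simp [sn]

theorem hasDerivAt_cs (t : ℝ) : HasDerivAt M.cs (-M.curvature * M.sn t) t := by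
  cases M
  · exact (hasDerivAt_const t (1 : ℝ)).congr_deriv (by simp [curvature])
  · exact (Real.hasDerivAt_cos t).congr_deriv (by simp [curvature, sn])
  · exact (Real.hasDerivAt_cosh t).congr_deriv (by simp [curvature, sn])

theorem hasDerivAt_sn (t : ℝ) : HasDerivAt M.sn (M.cs t) t := by
  cases M
  · exact hasDerivAt_id t
  · exact Real.hasDerivAt_sin t
  · exact Real.hasDerivAt_sinh t

theorem contDiff_cs : ContDiff ℝ ∞ M.cs := by
  cases M
  · exact contDiff_const
  · exact Real.contDiff_cos
  · exact Real.contDiff_cosh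

theorem contDiff_sn : ContDiff ℝ ∞ M.sn := by
  cases M
  · exact contDiff_id
  · exact Real.contDiff_sin
  · exact Real.contDiff_sinh

theorem cs_sq_add (t : ℝ) : M.cs t ^ 2 + M.curvature * M.sn t ^ 2 = 1 := by
  cases M
  · simp [cs, curvature]
  · simp [cs, sn, curvature]
  · simp only [cs, sn, curvature]
    linarith [Real.cosh_sq t]

/-- The geodesic through `x` with initial velocity `r • u`, for a unit vector `u` at `x`. -/
def modelGeodesic (x u : M.Ambient) (r t : ℝ) : M.Ambient :=
  M.cs (r * t) • x + M.sn (r * t) • u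

theorem modelGeodesic_mem {x u : M.Ambient} (hx : x ∈ M.carrier)
    (hu : M.curvature * M.metric x u = 0) (hu1 : M.metric u u = 1) (r t : ℝ) :
    M.modelGeodesic x u r t ∈ M.carrier := by
  have hq : M.curvature * M.metric (M.modelGeodesic x u r t) (M.modelGeodesic x u r t)
      = M.curvature ^ 2 := by
    simp only [modelGeodesic, metric_add_left, metric_add_right, metric_smul_left,
      metric_smul_right, M.metric_comm u x, hu1]
    linear_combination M.cs (r * t) ^ 2 * M.curvature_mul_metric_self hx +
      2 * M.cs (r * t) * M.sn (r * t) * hu + M.curvature ^ 2 * M.cs_sq_add (r * t) -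
      M.sn (r * t) ^ 2 * M.curvature_pow_three
  cases M
  · exact Set.mem_univ _
  · have h : inner ℝ (modelGeodesic _ x u r t) (modelGeodesic _ x u r t) = (1 : ℝ) := by
      simpa [curvature, metric] using hq
    rw [real_inner_self_eq_norm_sq,
      pow_eq_one_iff_of_nonneg (norm_nonneg _) two_ne_zero] at h
    simpa [carrier] using h
  · refine ⟨by simpa [curvature, metric, neg_eq_iff_eq_neg] using hq, ?_⟩
    -- The point stays on the upper sheet since `|u₀| < x₀` and `|sinh| < cosh`.
    have hxu : minkowski x u = 0 := by simpa [curvature, metric] using hu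
    have h := minkowski_sq_le hx.1 hxu
    rw [show minkowski u u = 1 from hu1, mul_one] at h
    have hx0 : 0 < (x : EuclideanSpace ℝ (Fin 4)) 0 := hx.2
    change 0 < Real.cosh (r * t) * (x : EuclideanSpace ℝ (Fin 4)) 0 +
      Real.sinh (r * t) * (u : EuclideanSpace ℝ (Fin 4)) 0
    have hu0 : |(u : EuclideanSpace ℝ (Fin 4)) 0| < (x : EuclideanSpace ℝ (Fin 4)) 0 :=
      abs_lt_of_sq_lt_sq (by linarith) hx0.le
    have hs : |Real.sinh (r * t)| < Real.cosh (r * t) :=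
      abs_lt_of_sq_lt_sq (by linarith [Real.cosh_sq (r * t)]) (Real.cosh_pos (r * t)).le
    have hprod := mul_lt_mul'' hs hu0 (abs_nonneg _) (abs_nonneg _)
    rw [← abs_mul] at hprod
    linarith [neg_abs_le (Real.sinh (r * t) * (u : EuclideanSpace ℝ (Fin 4)) 0)]

theorem hasDerivAt_modelGeodesic (x u : M.Ambient) (r t : ℝ) :
    HasDerivAt (M.modelGeodesic x u r)
      ((r * M.cs (r * t)) • u - (M.curvature * r * M.sn (r * t)) • x) t := by
  have hr : HasDerivAt (fun t => r * t) r t := by simpa using (hasDerivAt_id t).const_mul r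
  refine ((((M.hasDerivAt_cs (r * t)).comp t hr).smul_const x).add
    (((M.hasDerivAt_sn (r * t)).comp t hr).smul_const u)).congr_deriv ?_
  module

theorem contDiff_modelGeodesic (x u : M.Ambient) (r : ℝ) :
    ContDiff ℝ ∞ (M.modelGeodesic x u r) := by
  have hr : ContDiff ℝ ∞ fun t : ℝ => r * t := contDiff_const.mul contDiff_id
  exact ((M.contDiff_cs.comp hr).smul contDiff_const).add
    ((M.contDiff_sn.comp hr).smul contDiff_const)

theorem mem_tangent_iff {x v : M.Ambient} (hx : x ∈ M.carrier) :
    v ∈ M.tangent x ↔ M.curvature * M.metric x v = 0 := by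
  refine ⟨M.curvature_mul_metric_eq_zero, fun hv => ?_⟩
  rcases eq_or_ne v 0 with rfl | hv0
  · exact ⟨fun _ => x, contDiff_const, fun _ => hx, rfl, by simp⟩
  have hpos := M.metric_self_pos hx hv hv0
  set r := √(M.metric v v) with hr
  have hr0 : r ≠ 0 := (Real.sqrt_pos.2 hpos).ne'
  refine ⟨M.modelGeodesic x (r⁻¹ • v) r, M.contDiff_modelGeodesic _ _ _, fun t =>
    M.modelGeodesic_mem hx ?_ ?_ r t, ?_, ?_⟩
  · rw [metric_smul_right, mul_left_comm, hv, mul_zero]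
  · rw [metric_smul_right, metric_smul_left, ← Real.sq_sqrt hpos.le, ← hr]
    field_simp
  · simp [modelGeodesic, cs_zero, sn_zero]
  · rw [(M.hasDerivAt_modelGeodesic _ _ _ _).deriv]
    simp [cs_zero, sn_zero, smul_smul, hr0]

theorem zero_mem_tangent {x : M.Ambient} (hx : x ∈ M.carrier) : (0 : M.Ambient) ∈ M.tangent x := by
  rw [M.mem_tangent_iff hx, metric_zero_right, mul_zero]

/-- A vector orthogonal to the tangent space is normal, that is, a multiple of the position vector
(and zero in Euclidean space). -/
theorem eq_smul_of_orthogonal_tangent {x w : M.Ambient} (hx : x ∈ M.carrier)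
    (hw : ∀ u ∈ M.tangent x, M.metric w u = 0) : w = (M.curvature * M.metric w x) • x := by
  have h3 := M.curvature_pow_three
  have hxx := M.curvature_mul_metric_self hx
  rw [← sub_eq_zero]
  refine M.eq_zero_of_metric_eq_zero fun y => ?_
  have hy : y - (M.curvature * M.metric y x) • x ∈ M.tangent x := by
    rw [M.mem_tangent_iff hx, metric_sub_right, metric_smul_right, M.metric_comm y x]
    linear_combination (-M.curvature * M.metric x y) * hxx - M.metric x y * h3
  have h1 := hw _ hy
  rw [metric_sub_right, metric_smul_right] at h1
  rw [metric_sub_left, metric_smul_left, M.metric_comm x y]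
  linarith

theorem modelGeodesic_isGeodesic {x u : M.Ambient} (hx : x ∈ M.carrier)
    (hu : M.curvature * M.metric x u = 0) (hu1 : M.metric u u = 1) (r : ℝ) :
    M.IsGeodesic (M.modelGeodesic x u r) := by
  refine ⟨M.contDiff_modelGeodesic x u r, M.modelGeodesic_mem hx hu hu1 r, fun t =>
    ⟨M.zero_mem_tangent (M.modelGeodesic_mem hx hu hu1 r t), fun w hw => ?_⟩⟩
  have hr : HasDerivAt (fun t => r * t) r t := by simpa using (hasDerivAt_id t).const_mul r
  have h1 : deriv (M.modelGeodesic x u r) = fun t =>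
      (r * M.cs (r * t)) • u - (M.curvature * r * M.sn (r * t)) • x :=
    funext fun t => (M.hasDerivAt_modelGeodesic x u r t).deriv
  have h2 : HasDerivAt (deriv (M.modelGeodesic x u r))
      ((-M.curvature * r ^ 2) • M.modelGeodesic x u r t) t := by
    rw [h1]
    refine (((((M.hasDerivAt_cs (r * t)).comp t hr).const_mul r).smul_const u).sub
      ((((M.hasDerivAt_sn (r * t)).comp t hr).const_mul (M.curvature * r)).smul_const
        x)).congr_deriv ?_
    simp only [modelGeodesic]
    module
  rw [h2.deriv, sub_zero, metric_smul_left]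
  linear_combination (-r ^ 2) * M.curvature_mul_metric_eq_zero hw

/-- The ambient derivative of a field is its covariant derivative plus a normal component. -/
theorem HasCovDeriv.deriv_eq {M : SpaceForm} {γ V : ℝ → M.Ambient} {W : M.Ambient} {s : ℝ}
    (h : M.HasCovDeriv γ V W s) (hγ : γ s ∈ M.carrier) :
    deriv V s = W + (M.curvature * M.metric (deriv V s) (γ s)) • γ s := by
  have h1 := M.eq_smul_of_orthogonal_tangent hγ h.2
  have h2 := (M.mem_tangent_iff hγ).1 h.1
  rw [metric_sub_left, M.metric_comm W, mul_sub, h2, sub_zero] at h1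
  rw [← h1]; abel

theorem IsGeodesic.deriv_mem_tangent {M : SpaceForm} {Γ : ℝ → M.Ambient} (h : M.IsGeodesic Γ)
    (t : ℝ) : deriv Γ t ∈ M.tangent (Γ t) := by
  refine ⟨fun s => Γ (t + s), h.1.comp (contDiff_const.add contDiff_id), fun s => h.2.1 _,
    by simp, ?_⟩
  rw [deriv_comp_const_add]; simp

/-- A geodesic satisfies the linear equation `Γ'' = -κ c Γ`, where `c` is the constant squared
speed. -/
theorem IsGeodesic.hasDerivAt_deriv {M : SpaceForm} {Γ : ℝ → M.Ambient} (h : M.IsGeodesic Γ)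
    (t : ℝ) :
    HasDerivAt (deriv Γ) ((-M.curvature * M.metric (deriv Γ 0) (deriv Γ 0)) • Γ t) t := by
  have hd : ∀ t, HasDerivAt Γ (deriv Γ t) t := fun t =>
    (h.1.differentiable (by simp)).differentiableAt.hasDerivAt
  have hdd : ∀ t, HasDerivAt (deriv Γ) (deriv (deriv Γ) t) t := fun t =>
    ((contDiff_infty_iff_deriv.1 h.1).2.differentiable (by simp)).differentiableAt.hasDerivAt
  have hspeed : ∀ t, M.metric (deriv Γ t) (deriv Γ t) = M.metric (deriv Γ 0) (deriv Γ 0) := by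
    intro t
    refine is_const_of_deriv_eq_zero (f := fun t => M.metric (deriv Γ t) (deriv Γ t))
      (fun t => ((hdd t).spaceFormMetric M (hdd t)).differentiableAt) (fun t => ?_) t 0
    rw [((hdd t).spaceFormMetric M (hdd t)).deriv]
    have := (h.2.2 t).2 _ (h.deriv_mem_tangent t)
    rw [sub_zero] at this
    rw [M.metric_comm (deriv Γ t), this, add_zero]
  have horth : ∀ t, M.curvature * M.metric (Γ t) (deriv Γ t) = 0 := fun t =>
    M.curvature_mul_metric_eq_zero (h.deriv_mem_tangent t)
  -- Differentiating the orthogonality of position and velocity gives the normal component.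
  have h1 := (((hd t).spaceFormMetric M (hdd t)).const_mul M.curvature).unique
    (((hasDerivAt_const t (0 : ℝ))).congr_of_eventuallyEq (.of_forall horth))
  rw [hspeed t, M.metric_comm (Γ t)] at h1
  refine (hdd t).congr_deriv ?_
  rw [(h.2.2 t).deriv_eq (h.2.1 t), zero_add]
  congr 1
  linarith

theorem IsGeodesic.apply_one {M : SpaceForm} {Γ : ℝ → M.Ambient} (h : M.IsGeodesic Γ)
    {u : M.Ambient} (hu1 : M.metric u u = 1) {r : ℝ} (hr : r ≠ 0) (hΓ : deriv Γ 0 = r • u) :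
    Γ 1 = M.modelGeodesic (Γ 0) u r 1 := by
  have hd : ∀ t, HasDerivAt Γ (deriv Γ t) t := fun t =>
    (h.1.differentiable (by simp)).differentiableAt.hasDerivAt
  have hdd : ∀ t, HasDerivAt (deriv Γ) ((-M.curvature * r ^ 2) • Γ t) t := fun t => by
    have := h.hasDerivAt_deriv t
    rwa [hΓ, metric_smul_left, metric_smul_right, hu1, mul_one, ← sq] at this
  have hm : ∀ t, HasDerivAt (fun t => r * t) r t := fun t => by
    simpa using (hasDerivAt_id t).const_mul r
  have hc : ∀ t, HasDerivAt (fun t => M.cs (r * t)) (-M.curvature * M.sn (r * t) * r) t :=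
    fun t => (M.hasDerivAt_cs (r * t)).comp t (hm t)
  have hs : ∀ t, HasDerivAt (fun t => M.sn (r * t)) (M.cs (r * t) * r) t :=
    fun t => (M.hasDerivAt_sn (r * t)).comp t (hm t)
  -- The initial data, recovered from the state at time `t`, do not depend on `t`.
  have hP : ∀ t, HasDerivAt
      (fun t => (r * M.cs (r * t)) • Γ t - M.sn (r * t) • deriv Γ t) 0 t := fun t => by
    refine ((((hc t).const_mul r).smul (hd t)).sub ((hs t).smul (hdd t))).congr_deriv ?_
    module
  have hQ : ∀ t, HasDerivAt
      (fun t => (M.curvature * r * M.sn (r * t)) • Γ t + M.cs (r * t) • deriv Γ t) 0 t :=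
    fun t => by
    refine ((((hs t).const_mul (M.curvature * r)).smul (hd t)).add
      ((hc t).smul (hdd t))).congr_deriv ?_
    module
  have eP := is_const_of_deriv_eq_zero (fun t => (hP t).differentiableAt)
    (fun t => (hP t).deriv) 1 0
  have eQ := is_const_of_deriv_eq_zero (fun t => (hQ t).differentiableAt)
    (fun t => (hQ t).deriv) 1 0
  simp only [mul_zero, cs_zero, sn_zero, zero_smul, mul_one, one_smul, sub_zero, zero_add,
    hΓ] at eP eQ
  have hcs := M.cs_sq_add r
  apply smul_right_injective _ hr
  simp only [modelGeodesic, mul_one, smul_add]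
  have e : r • Γ 1 = M.cs r • ((r * M.cs r) • Γ 1 - M.sn r • deriv Γ 1) +
      M.sn r • ((M.curvature * r * M.sn r) • Γ 1 + M.cs r • deriv Γ 1) := by
    have : r • Γ 1 = (r * (M.cs r ^ 2 + M.curvature * M.sn r ^ 2)) • Γ 1 := by rw [hcs, mul_one]
    rw [this]
    module
  rw [e, eP, eQ]
  module

/-- The choice in the definition of `exp` is determined, by existence and uniqueness of the geodesic
with given initial data. -/
theorem exp_smul {x u : M.Ambient} (hx : x ∈ M.carrier) (hu : M.curvature * M.metric x u = 0)
    (hu1 : M.metric u u = 1) {r : ℝ} (hr : r ≠ 0) :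
    M.exp x (r • u) = M.cs r • x + M.sn r • u := by
  have hex : ∃ y, ∃ Γ : ℝ → M.Ambient,
      M.IsGeodesic Γ ∧ Γ 0 = x ∧ deriv Γ 0 = r • u ∧ Γ 1 = y := by
    refine ⟨_, _, M.modelGeodesic_isGeodesic hx hu hu1 r, ?_, ?_, rfl⟩
    · simp [modelGeodesic, cs_zero, sn_zero]
    · rw [(M.hasDerivAt_modelGeodesic _ _ _ _).deriv]
      simp [cs_zero, sn_zero]
  obtain ⟨Γ, hΓ, h0, h1, h2⟩ := Classical.epsilon_spec hex
  have h3 := hΓ.apply_one hu1 hr h1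
  rw [exp, ← h2, h3, h0, modelGeodesic, mul_one]

end SpaceForm

namespace SpaceForm

/-! ### The Frenet frame in the ambient space -/

namespace IsFrenetCurve

variable {M : SpaceForm} {I : Set ℝ} {γ N B : ℝ → M.Ambient} {k₁ k₂ : ℝ → ℝ}
  (h : M.IsFrenetCurve I γ N B k₁ k₂) (hI : IsOpen I)
include h hI

theorem hasDerivAt {s : ℝ} (hs : s ∈ I) : HasDerivAt γ (deriv γ s) s :=
  ((h.smooth.differentiableOn (by simp)).differentiableAt (hI.mem_nhds hs)).hasDerivAt

/-- For a tangent field orthogonal to the curve, the ambient derivative has no normal component, so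
it is the covariant derivative. -/
theorem deriv_eq_of_hasCovDeriv {V : ℝ → M.Ambient} {W : M.Ambient} {s : ℝ} (hs : s ∈ I)
    (hV : ContDiffOn ℝ ∞ V I) (hVt : ∀ s ∈ I, V s ∈ M.tangent (γ s))
    (hVT : M.metric (deriv γ s) (V s) = 0) (hcov : M.HasCovDeriv γ V W s) :
    HasDerivAt V W s := by
  have hd := ((hV.differentiableOn (by simp)).differentiableAt (hI.mem_nhds hs)).hasDerivAt
  have h1 := (((h.hasDerivAt hI hs).spaceFormMetric M hd).const_mul M.curvature).unique
    ((hasDerivAt_const s (0 : ℝ)).congr_of_eventuallyEq <|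
      Filter.eventuallyEq_of_mem (hI.mem_nhds hs) fun t ht =>
        M.curvature_mul_metric_eq_zero (hVt t ht))
  rw [hVT, add_zero, M.metric_comm] at h1
  refine hd.congr_deriv ?_
  conv_lhs => rw [hcov.deriv_eq (h.mem s hs)]
  rw [h1, zero_smul, add_zero]

theorem hasDerivAt_N {s : ℝ} (hs : s ∈ I) :
    HasDerivAt N (-k₁ s • deriv γ s + k₂ s • B s) s :=
  h.deriv_eq_of_hasCovDeriv hI hs h.smooth_N h.tangent_N (h.orth_TN s hs) (h.frenet_N s hs)

theorem hasDerivAt_B {s : ℝ} (hs : s ∈ I) : HasDerivAt B (-k₂ s • N s) s :=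
  h.deriv_eq_of_hasCovDeriv hI hs h.smooth_B h.tangent_B (h.orth_TB s hs) (h.frenet_B s hs)

omit hI in
theorem curvature_smul_N {s : ℝ} (hs : s ∈ I) : k₁ s • N s = deriv (deriv γ) s -
    (M.curvature * M.metric (deriv (deriv γ) s) (γ s)) • γ s :=
  eq_sub_of_add_eq ((h.frenet_T s hs).deriv_eq (h.mem s hs)).symm

end IsFrenetCurve

/-! ### The tube in the ambient space -/

section Tube

variable {M : SpaceForm}

/-- The unit normal vector of the curve at `q 0` in the direction of the angle `q 1`. -/
def radial (N B : ℝ → M.Ambient) (q : Fin 2 → ℝ) : M.Ambient :=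
  Real.cos (q 1) • N (q 0) + Real.sin (q 1) • B (q 0)

/-- The derivative of `radial` with respect to the angle. -/
def angular (N B : ℝ → M.Ambient) (q : Fin 2 → ℝ) : M.Ambient :=
  Real.cos (q 1) • B (q 0) - Real.sin (q 1) • N (q 0)

theorem normalVector_eq (N B : ℝ → M.Ambient) (ρ : ℝ) (q : Fin 2 → ℝ) :
    M.normalVector N B ρ q = ρ • radial N B q := by
  simp only [normalVector, radial]
  module

/-- The component along `deriv γ` of the `s`-derivative of the tube. -/
def tubeStretch (M : SpaceForm) (c₁ ρ ψ : ℝ) : ℝ := M.cs ρ - M.sn ρ * c₁ * Real.cos ψ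

variable {I : Set ℝ} {γ N B : ℝ → M.Ambient} {k₁ k₂ : ℝ → ℝ}

theorem isOpen_tubeDomain (hI : IsOpen I) : IsOpen (tubeDomain I) :=
  hI.preimage (continuous_apply 0)

namespace IsFrenetCurve

variable (h : M.IsFrenetCurve I γ N B k₁ k₂) (hI : IsOpen I)
include h

theorem metric_N_smul_add {s : ℝ} (hs : s ∈ I) (a b : ℝ) :
    M.metric (N s) (a • N s + b • B s) = a := by
  rw [metric_add_right, metric_smul_right, metric_smul_right, h.unit_N s hs, h.orth_NB s hs]
  ring

theorem metric_B_smul_add {s : ℝ} (hs : s ∈ I) (a b : ℝ) :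
    M.metric (B s) (a • N s + b • B s) = b := by
  rw [metric_add_right, metric_smul_right, metric_smul_right, h.unit_B s hs, M.metric_comm (B s),
    h.orth_NB s hs]
  ring

theorem tube_eq {ρ : ℝ} (hρ : ρ ≠ 0) {q : Fin 2 → ℝ} (hq : q ∈ tubeDomain I) :
    M.tube γ N B ρ q = M.cs ρ • γ (q 0) + M.sn ρ • radial N B q := by
  have hx := h.mem _ hq
  rw [tube, normalVector_eq]
  refine M.exp_smul hx ?_ ?_ hρ
  · rw [radial, metric_add_right, metric_smul_right, metric_smul_right]
    linear_combination Real.cos (q 1) * M.curvature_mul_metric_eq_zero (h.tangent_N _ hq) +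
      Real.sin (q 1) * M.curvature_mul_metric_eq_zero (h.tangent_B _ hq)
  · conv_lhs => rw [radial, metric_add_left, metric_smul_left, metric_smul_left]
    rw [h.metric_N_smul_add hq, h.metric_B_smul_add hq]
    linear_combination Real.cos_sq_add_sin_sq (q 1)

include hI

theorem hasDerivAt_tube_comp_update {ρ : ℝ} (hρ : ρ ≠ 0) {q : Fin 2 → ℝ} (hq : q ∈ tubeDomain I)
    (i : Fin 2) :
    HasDerivAt (fun t => M.cs ρ • γ (Function.update q i t 0) +
        M.sn ρ • radial N B (Function.update q i t))
      (coordVector (M.tube γ N B ρ) i q) (q i) := by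
  have hev : M.tube γ N B ρ =ᶠ[nhds q] fun q => M.cs ρ • γ (q 0) + M.sn ρ • radial N B q :=
    Filter.eventuallyEq_of_mem ((isOpen_tubeDomain hI).mem_nhds hq) fun q hq => h.tube_eq hρ hq
  have hγ : DifferentiableAt ℝ (fun q : Fin 2 → ℝ => γ (q 0)) q :=
    (h.hasDerivAt hI hq).differentiableAt.comp q (differentiableAt_apply 0 q)
  have hN : DifferentiableAt ℝ (fun q : Fin 2 → ℝ => N (q 0)) q :=
    (h.hasDerivAt_N hI hq).differentiableAt.comp q (differentiableAt_apply 0 q)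
  have hB : DifferentiableAt ℝ (fun q : Fin 2 → ℝ => B (q 0)) q :=
    (h.hasDerivAt_B hI hq).differentiableAt.comp q (differentiableAt_apply 0 q)
  have hd : DifferentiableAt ℝ
      (fun q : Fin 2 → ℝ => M.cs ρ • γ (q 0) + M.sn ρ • radial N B q) q := by
    have h1 : DifferentiableAt ℝ (fun q : Fin 2 → ℝ => q 1) q := differentiableAt_apply 1 q
    exact (hγ.const_smul (M.cs ρ)).add
      (((h1.cos.smul hN).add (h1.sin.smul hB)).const_smul (M.sn ρ))
  rw [coordVector, hev.fderiv_eq]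
  have hup := hasDerivAt_update q i (q i)
  rw [← Function.update_eq_self i q] at hd
  have := hd.hasFDerivAt.comp_hasDerivAt (q i) hup
  rwa [Function.update_eq_self] at this

theorem coordVector_tube_zero {ρ : ℝ} (hρ : ρ ≠ 0) {q : Fin 2 → ℝ} (hq : q ∈ tubeDomain I) :
    coordVector (M.tube γ N B ρ) 0 q =
      M.tubeStretch (k₁ (q 0)) ρ (q 1) • deriv γ (q 0) + (M.sn ρ * k₂ (q 0)) • angular N B q := by
  refine (h.hasDerivAt_tube_comp_update hI hρ hq 0).unique ?_
  simp only [radial, Function.update_self, ne_eq, one_ne_zero, not_false_eq_true,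
    Function.update_of_ne]
  refine (((h.hasDerivAt hI hq).const_smul (M.cs ρ)).add
    ((((h.hasDerivAt_N hI hq).const_smul (Real.cos (q 1))).add
      ((h.hasDerivAt_B hI hq).const_smul (Real.sin (q 1)))).const_smul (M.sn ρ))).congr_deriv ?_
  simp only [tubeStretch, angular]
  module

theorem coordVector_tube_one {ρ : ℝ} (hρ : ρ ≠ 0) {q : Fin 2 → ℝ} (hq : q ∈ tubeDomain I) :
    coordVector (M.tube γ N B ρ) 1 q = M.sn ρ • angular N B q := by
  refine (h.hasDerivAt_tube_comp_update hI hρ hq 1).unique ?_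
  simp only [radial, Function.update_self, ne_eq, zero_ne_one, not_false_eq_true,
    Function.update_of_ne]
  refine ((hasDerivAt_const (q 1) (M.cs ρ • γ (q 0))).add
    ((((Real.hasDerivAt_cos (q 1)).smul_const (N (q 0))).add
      ((Real.hasDerivAt_sin (q 1)).smul_const (B (q 0)))).const_smul (M.sn ρ))).congr_deriv ?_
  simp only [angular]
  module

/-! ### Parameters of one point of the tube -/

/-- Along a geodesic the Frenet frame rotates, relative to fixed ambient vectors, by the angle
`c₂ s`. -/
theorem frame_rotation_of_geodesic (hIc : IsPreconnected I) {c₂ : ℝ} (hk₁ : ∀ s ∈ I, k₁ s = 0)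
    (hk₂ : ∀ s ∈ I, k₂ s = c₂) {s s' : ℝ} (hs : s ∈ I) (hs' : s' ∈ I) :
    N s' = Real.cos (c₂ * (s' - s)) • N s + Real.sin (c₂ * (s' - s)) • B s ∧
      B s' = -Real.sin (c₂ * (s' - s)) • N s + Real.cos (c₂ * (s' - s)) • B s := by
  have hm : ∀ t : ℝ, HasDerivAt (fun t => c₂ * t) c₂ t := fun t => by
    simpa using (hasDerivAt_id t).const_mul c₂
  have hP : ∀ t ∈ I, HasDerivAt
      (fun t => Real.cos (c₂ * t) • N t - Real.sin (c₂ * t) • B t) 0 t := fun t ht => by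
    refine (((hm t).cos.smul (h.hasDerivAt_N hI ht)).sub
      ((hm t).sin.smul (h.hasDerivAt_B hI ht))).congr_deriv ?_
    rw [hk₁ t ht, hk₂ t ht]
    module
  have hQ : ∀ t ∈ I, HasDerivAt
      (fun t => Real.sin (c₂ * t) • N t + Real.cos (c₂ * t) • B t) 0 t := fun t ht => by
    refine (((hm t).sin.smul (h.hasDerivAt_N hI ht)).add
      ((hm t).cos.smul (h.hasDerivAt_B hI ht))).congr_deriv ?_
    rw [hk₁ t ht, hk₂ t ht]
    module
  have eP := hI.is_const_of_deriv_eq_zero hIc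
    (fun t ht => (hP t ht).differentiableAt.differentiableWithinAt)
    (fun t ht => (hP t ht).deriv) hs' hs
  have eQ := hI.is_const_of_deriv_eq_zero hIc
    (fun t ht => (hQ t ht).differentiableAt.differentiableWithinAt)
    (fun t ht => (hQ t ht).deriv) hs' hs
  have hcs := Real.cos_sq_add_sin_sq (c₂ * s')
  rw [mul_sub, Real.cos_sub, Real.sin_sub]
  constructor
  · have : N s' = Real.cos (c₂ * s') • (Real.cos (c₂ * s') • N s' - Real.sin (c₂ * s') • B s') +
        Real.sin (c₂ * s') • (Real.sin (c₂ * s') • N s' + Real.cos (c₂ * s') • B s') := by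
      conv_lhs => rw [← one_smul ℝ (N s'), ← hcs]
      module
    rw [this, eP, eQ]
    module
  · have : B s' = Real.cos (c₂ * s') • (Real.sin (c₂ * s') • N s' + Real.cos (c₂ * s') • B s') -
        Real.sin (c₂ * s') • (Real.cos (c₂ * s') • N s' - Real.sin (c₂ * s') • B s') := by
      conv_lhs => rw [← one_smul ℝ (B s'), ← hcs]
      module
    rw [this, eP, eQ]
    module

omit hI in
/-- At parameters of one point of a simple curve, the tangent vectors and the curvature vectors
agree. -/
theorem deriv_eq_of_apply_eq (hsimple : M.IsSimpleCurve I γ) {s s' : ℝ} (hs : s ∈ I) (hs' : s' ∈ I)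
    (hγ : γ s = γ s') : deriv γ s = deriv γ s' ∧ k₁ s • N s = k₁ s' • N s' := by
  rcases hsimple with hinj | ⟨-, L, -, hL⟩
  · rw [hinj hs hs' hγ]; exact ⟨rfl, rfl⟩
  · obtain ⟨m, rfl⟩ := (hL s s').1 hγ
    have hper : (fun t => γ (t + m * L)) = γ := funext fun t => ((hL _ _).2 ⟨m, rfl⟩).symm
    have h1 : (fun t => deriv γ (t + m * L)) = deriv γ := funext fun t => by
      rw [← deriv_comp_add_const, hper]
    have h2 : deriv (deriv γ) (s + m * L) = deriv (deriv γ) s := by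
      rw [← deriv_comp_add_const, h1]
    exact ⟨(congrFun h1 s).symm, by
      rw [h.curvature_smul_N hs, h.curvature_smul_N hs', h2, ← hγ]⟩

/-- At parameters of one point of a simple curve of constant curvatures, the frames of the normal
plane differ by a rotation.  This excludes the reflections that the unit tangent vector alone
would allow. -/
theorem exists_frame_rotation (hIc : IsPreconnected I) (hsimple : M.IsSimpleCurve I γ) {c₁ c₂ : ℝ}
    (hk₁ : ∀ s ∈ I, k₁ s = c₁) (hk₂ : ∀ s ∈ I, k₂ s = c₂) {s s' : ℝ} (hs : s ∈ I) (hs' : s' ∈ I)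
    (hγ : γ s = γ s') :
    ∃ θ : ℝ, N s' = Real.cos θ • N s + Real.sin θ • B s ∧
      B s' = -Real.sin θ • N s + Real.cos θ • B s := by
  rcases eq_or_ne c₁ 0 with rfl | hc₁
  · exact ⟨_, h.frame_rotation_of_geodesic hI hIc hk₁ hk₂ hs hs'⟩
  suffices N s' = N s ∧ B s' = B s from ⟨0, by simp [this]⟩
  have hN : ∀ {t t'}, t ∈ I → t' ∈ I → γ t = γ t' → N t = N t' := fun ht ht' e => by
    have := (h.deriv_eq_of_apply_eq hsimple ht ht' e).2
    rw [hk₁ _ ht, hk₁ _ ht'] at this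
    exact smul_right_injective _ hc₁ this
  refine ⟨(hN hs hs' hγ).symm, ?_⟩
  rcases eq_or_ne c₂ 0 with rfl | hc₂
  · refine hI.is_const_of_deriv_eq_zero hIc
      (fun t ht => (h.hasDerivAt_B hI ht).differentiableAt.differentiableWithinAt)
      (fun t ht => ?_) hs' hs
    rw [(h.hasDerivAt_B hI ht).deriv, hk₂ t ht, neg_zero, zero_smul, Pi.zero_apply]
  · rcases hsimple with hinj | ⟨rfl, L, hLpos, hL⟩
    · rw [hinj hs hs' hγ]
    obtain ⟨m, rfl⟩ := (hL s s').1 hγ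
    have hper : (fun t => N (t + m * L)) = N := funext fun t =>
      (hN (Set.mem_univ _) (Set.mem_univ _) ((hL _ _).2 ⟨m, rfl⟩)).symm
    have hN' : deriv N (s + m * L) = deriv N s := by rw [← deriv_comp_add_const, hper]
    have hT := (h.deriv_eq_of_apply_eq (.inr ⟨rfl, L, hLpos, hL⟩) hs hs' hγ).1
    rw [(h.hasDerivAt_N hI hs).deriv, (h.hasDerivAt_N hI hs').deriv, ← hT, hk₁ _ hs, hk₁ _ hs',
      hk₂ _ hs, hk₂ _ hs'] at hN'
    exact smul_right_injective _ hc₂ (add_left_cancel hN')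

/-- The coordinate frame of the tube is attached to the point of the tube, not to the parameters
`(s, ψ)` that describe it.  Hence both momenta are functions on the cotangent bundle. -/
theorem coordVector_tube_eq (hIc : IsPreconnected I) (hsimple : M.IsSimpleCurve I γ) {c₁ c₂ : ℝ}
    (hk₁ : ∀ s ∈ I, k₁ s = c₁) (hk₂ : ∀ s ∈ I, k₂ s = c₂) {ρ : ℝ} (hρ : ρ ≠ 0)
    {q q' : Fin 2 → ℝ} (hq : q ∈ tubeDomain I) (hq' : q' ∈ tubeDomain I)
    (hγ : γ (q 0) = γ (q' 0)) (hr : radial N B q = radial N B q') (i : Fin 2) :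
    coordVector (M.tube γ N B ρ) i q = coordVector (M.tube γ N B ρ) i q' := by
  obtain ⟨θ, hN, hB⟩ := h.exists_frame_rotation hI hIc hsimple hk₁ hk₂ hq hq' hγ
  obtain ⟨hT, hkN⟩ := h.deriv_eq_of_apply_eq hsimple hq hq' hγ
  have hr' : radial N B q' =
      Real.cos (q' 1 + θ) • N (q 0) + Real.sin (q' 1 + θ) • B (q 0) := by
    rw [radial, hN, hB, Real.cos_add, Real.sin_add]
    module
  have hcos : Real.cos (q 1) = Real.cos (q' 1 + θ) := by
    rw [← h.metric_N_smul_add hq (Real.cos (q 1)) (Real.sin (q 1)), ← radial, hr, hr',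
      h.metric_N_smul_add hq]
  have hsin : Real.sin (q 1) = Real.sin (q' 1 + θ) := by
    rw [← h.metric_B_smul_add hq (Real.cos (q 1)) (Real.sin (q 1)), ← radial, hr, hr',
      h.metric_B_smul_add hq]
  have hang : angular N B q = angular N B q' := by
    simp only [angular]
    rw [hN, hB, hcos, hsin, Real.cos_add, Real.sin_add]
    module
  -- `k₁ cos ψ` is the scalar product of the curvature vector with the radial vector.
  have hkc : k₁ (q 0) * Real.cos (q 1) = k₁ (q' 0) * Real.cos (q' 1) := by
    have e1 : M.metric (k₁ (q 0) • N (q 0)) (radial N B q) = k₁ (q 0) * Real.cos (q 1) := by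
      rw [metric_smul_left, radial, h.metric_N_smul_add hq]
    have e2 : M.metric (k₁ (q' 0) • N (q' 0)) (radial N B q') = k₁ (q' 0) * Real.cos (q' 1) := by
      rw [metric_smul_left, radial, h.metric_N_smul_add hq']
    rw [← e1, ← e2, hkN, hr]
  fin_cases i
  · change coordVector _ 0 q = coordVector _ 0 q'
    rw [h.coordVector_tube_zero hI hρ hq, h.coordVector_tube_zero hI hρ hq', hang, hT, hk₂ _ hq,
      hk₂ _ hq', tubeStretch, tubeStretch, mul_assoc, mul_assoc, hkc]
  · change coordVector _ 1 q = coordVector _ 1 q'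
    rw [h.coordVector_tube_one hI hρ hq, h.coordVector_tube_one hI hρ hq', hang]

/-! ### The induced line element -/

theorem lineElement_tube {ρ : ℝ} (hρ : ρ ≠ 0) {q : Fin 2 → ℝ} (hq : q ∈ tubeDomain I) :
    M.lineElement (M.tube γ N B ρ) q =
      !![M.tubeStretch (k₁ (q 0)) ρ (q 1) ^ 2 + M.sn ρ ^ 2 * k₂ (q 0) ^ 2, M.sn ρ ^ 2 * k₂ (q 0);
        M.sn ρ ^ 2 * k₂ (q 0), M.sn ρ ^ 2] := by
  have hTA : M.metric (deriv γ (q 0)) (angular N B q) = 0 := by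
    rw [angular, metric_sub_right, metric_smul_right, metric_smul_right, h.orth_TN _ hq,
      h.orth_TB _ hq]
    ring
  have hAA : M.metric (angular N B q) (angular N B q) = 1 := by
    simp only [angular, metric_sub_right, metric_smul_right, metric_sub_left, metric_smul_left,
      h.unit_N _ hq, h.unit_B _ hq, h.orth_NB _ hq, M.metric_comm (B (q 0)) (N (q 0))]
    linear_combination Real.cos_sq_add_sin_sq (q 1)
  ext i j
  fin_cases i <;> fin_cases j <;>
  · simp [lineElement, h.coordVector_tube_zero hI hρ hq, h.coordVector_tube_one hI hρ hq,
      metric_add_right, metric_smul_right, metric_add_left, metric_smul_left, hTA, hAA,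
      h.unit_T _ hq, M.metric_comm (angular N B q) (deriv γ (q 0))]
    try ring

/-- The tube is immersed only away from the focal points of the curve. -/
theorem ne_zero_of_linearIndependent {ρ : ℝ} (hρ : ρ ≠ 0) {q : Fin 2 → ℝ} (hq : q ∈ tubeDomain I)
    (hli : LinearIndependent ℝ fun i => coordVector (M.tube γ N B ρ) i q) :
    M.sn ρ ≠ 0 ∧ M.tubeStretch (k₁ (q 0)) ρ (q 1) ≠ 0 := by
  constructor
  · intro h0
    apply hli.ne_zero 1
    rw [h.coordVector_tube_one hI hρ hq, h0, zero_smul]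
  · intro h0
    have h2 := Fintype.linearIndependent_iff.1 hli ![1, -k₂ (q 0)] (by
      simp only [Fin.sum_univ_two, h.coordVector_tube_one hI hρ hq,
        h.coordVector_tube_zero hI hρ hq, h0, Matrix.cons_val_zero, Matrix.cons_val_one]
      module) 0
    simp at h2

theorem geodesicHamiltonian_tube {ρ : ℝ} (hρ : ρ ≠ 0) {z : Phase 2}
    (hz : z ∈ phaseDomain (tubeDomain I))
    (hli : LinearIndependent ℝ fun i => coordVector (M.tube γ N B ρ) i z.1) :
    M.geodesicHamiltonian (M.tube γ N B ρ) z = 1 / 2 *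
      ((z.2 0 - k₂ (z.1 0) * z.2 1) ^ 2 / M.tubeStretch (k₁ (z.1 0)) ρ (z.1 1) ^ 2 +
        z.2 1 ^ 2 / M.sn ρ ^ 2) := by
  obtain ⟨hS, hA⟩ := h.ne_zero_of_linearIndependent hI hρ hz hli
  rw [geodesicHamiltonian, h.lineElement_tube hI hρ hz]
  generalize M.tubeStretch (k₁ (z.1 0)) ρ (z.1 1) = a at *
  generalize M.sn ρ = S at *
  generalize k₂ (z.1 0) = c at *
  rw [Matrix.inv_eq_right_inv (B := !![1 / a ^ 2, -c / a ^ 2;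
    -c / a ^ 2, c ^ 2 / a ^ 2 + 1 / S ^ 2])]
  · simp only [Fin.sum_univ_two, Matrix.of_apply, Matrix.cons_val', Matrix.cons_val_zero,
      Matrix.cons_val_one, Matrix.cons_val_fin_one]
    field_simp
    ring
  · ext i j
    fin_cases i <;> fin_cases j <;> simp [Matrix.mul_apply, Fin.sum_univ_two] <;> field_simp <;>
      ring

end IsFrenetCurve

end Tube

end SpaceForm

/-! ### Poisson brackets and first integrals -/

section Hamiltonian

variable {n : ℕ}

theorem fderiv_phase_apply (f : Phase n → ℝ) (z w : Phase n) :
    fderiv ℝ f z w = ∑ i, (w.1 i * derivQ f i z + w.2 i * derivP f i z) := by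
  have h1 : w = ∑ i, (w.1 i • ((Pi.single i 1, 0) : Phase n) +
      w.2 i • ((0, Pi.single i 1) : Phase n)) := by
    refine Prod.ext ?_ ?_ <;> ext j <;>
      simp [Prod.fst_sum, Prod.snd_sum, Finset.sum_apply, Pi.single_apply]
  conv_lhs => rw [h1]
  simp only [map_sum, map_add, map_smul, smul_eq_mul, derivQ, derivP]

theorem isOpen_phaseDomain {U : Set (Fin n → ℝ)} (hU : IsOpen U) : IsOpen (phaseDomain U) :=
  hU.preimage continuous_fst

theorem poisson_self (f : Phase n → ℝ) (z : Phase n) : poisson f f z = 0 :=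
  Finset.sum_eq_zero fun _ _ => by ring

theorem poisson_comm (f g : Phase n → ℝ) (z : Phase n) : poisson f g z = -poisson g f z := by
  rw [poisson, poisson, ← Finset.sum_neg_distrib]
  exact Finset.sum_congr rfl fun _ _ => by ring

theorem isFirstIntegral_of_poisson_eq_zero {U : Set (Fin n → ℝ)} {H F : Phase n → ℝ}
    (hF : ∀ z ∈ phaseDomain U, DifferentiableAt ℝ F z)
    (hP : ∀ z ∈ phaseDomain U, poisson F H z = 0) : IsFirstIntegral U H F := by
  intro J hJ hJc z hz t ht t' ht'
  have hd : ∀ t ∈ J, HasDerivAt (F ∘ z) 0 t := fun t ht => by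
    refine ((hF _ (hz t ht).1).hasFDerivAt.comp_hasDerivAt t (hz t ht).2).congr_deriv ?_
    rw [← hP _ (hz t ht).1, fderiv_phase_apply]
    exact Finset.sum_congr rfl fun i _ => by simp only [hamiltonianField]; ring
  exact hJ.is_const_of_deriv_eq_zero hJc
    (fun t ht => (hd t ht).differentiableAt.differentiableWithinAt)
    (fun t ht => (hd t ht).deriv) ht ht'

theorem hasFDerivAt_momentum (i : Fin n) (z : Phase n) :
    HasFDerivAt (fun z : Phase n => z.2 i)
      ((ContinuousLinearMap.proj (R := ℝ) i).comp (ContinuousLinearMap.snd ℝ _ _)) z :=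
  ((ContinuousLinearMap.proj (R := ℝ) i).comp
    (ContinuousLinearMap.snd ℝ (Fin n → ℝ) (Fin n → ℝ))).hasFDerivAt

/-- In particular, the momentum conjugate to a cyclic coordinate Poisson commutes with `H`. -/
theorem poisson_momentum (H : Phase n → ℝ) (i : Fin n) (z : Phase n) :
    poisson H (fun z : Phase n => z.2 i) z = derivQ H i z := by
  simp [poisson, derivQ, derivP, (hasFDerivAt_momentum i z).fderiv, Pi.single_apply]

end Hamiltonian

/-! ### Metrics with a cyclic coordinate -/

/-- The Hamiltonian `½ ((p₀ - c p₁)² / a(q₁)² + p₁² / S²)`, in which the coordinate `q₀` is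
cyclic. -/
def cyclicHamiltonian (a : ℝ → ℝ) (c S : ℝ) (z : Phase 2) : ℝ :=
  1 / 2 * ((z.2 0 - c * z.2 1) ^ 2 / a (z.1 1) ^ 2 + z.2 1 ^ 2 / S ^ 2)

section CyclicHamiltonian

variable {a : ℝ → ℝ} {c S : ℝ}

theorem contDiff_cyclicHamiltonian (ha : ContDiff ℝ ∞ a) (ha0 : ∀ t, a t ≠ 0) :
    ContDiff ℝ ∞ (cyclicHamiltonian a c S) := by
  have h1 : ∀ i : Fin 2, ContDiff ℝ ∞ fun z : Phase 2 => z.2 i := fun i =>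
    (contDiff_apply ℝ ℝ i).comp contDiff_snd
  have h2 : ContDiff ℝ ∞ fun z : Phase 2 => a (z.1 1) :=
    ha.comp ((contDiff_apply ℝ ℝ (1 : Fin 2)).comp contDiff_fst)
  exact contDiff_const.mul (((((h1 0).sub (contDiff_const.mul (h1 1))).pow 2).div (h2.pow 2)
    fun z => pow_ne_zero 2 (ha0 _)).add (((h1 1).pow 2).div_const _))

variable (ha : ContDiff ℝ ∞ a) (ha0 : ∀ t, a t ≠ 0)
include ha ha0

theorem derivQ_cyclicHamiltonian (z : Phase 2) : derivQ (cyclicHamiltonian a c S) 0 z = 0 := by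
  rw [derivQ, ← ((contDiff_cyclicHamiltonian ha ha0).differentiable (by simp)
    z).lineDeriv_eq_fderiv, lineDeriv]
  simp [cyclicHamiltonian]

theorem derivP_cyclicHamiltonian (z : Phase 2) : derivP (cyclicHamiltonian a c S) 1 z =
    -c * (z.2 0 - c * z.2 1) / a (z.1 1) ^ 2 + z.2 1 / S ^ 2 := by
  rw [derivP, ← ((contDiff_cyclicHamiltonian ha ha0).differentiable (by simp)
    z).lineDeriv_eq_fderiv, lineDeriv]
  have h1 : HasDerivAt (fun t : ℝ => z.2 1 + t) 1 0 := (hasDerivAt_id 0).const_add _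
  have h2 : HasDerivAt (fun t : ℝ => z.2 0 - c * (z.2 1 + t)) (-(c * 1)) 0 :=
    (h1.const_mul c).const_sub _
  have h3 := ((((h2.pow 2).div_const (a (z.1 1) ^ 2)).add
    ((h1.pow 2).div_const (S ^ 2))).const_mul (1 / 2)).deriv
  simp only [cyclicHamiltonian]
  convert h3 using 1
  · congr 1
    ext t
    simp
  · simp
    ring

/-- On a cotangent fibre, `∂H/∂p₁` is a linear form that is not identically zero, so it vanishes on
a nowhere dense set only. -/
theorem functionallyIndependent_cyclicHamiltonian (hS : S ≠ 0) {U : Set (Fin 2 → ℝ)}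
    {H : Phase 2 → ℝ}
    (hH : ∀ z ∈ phaseDomain U, fderiv ℝ H z = fderiv ℝ (cyclicHamiltonian a c S) z) :
    FunctionallyIndependent U ![H, fun z : Phase 2 => z.2 0] := by
  have key : ∀ z ∈ phaseDomain U, derivP (cyclicHamiltonian a c S) 1 z ≠ 0 →
      LinearIndependent ℝ fun i => fderiv ℝ ((![H, fun z : Phase 2 => z.2 0] :
        Fin 2 → Phase 2 → ℝ) i) z := by
    intro z hz hne
    rw [Fintype.linearIndependent_iff]
    intro g hg
    simp only [Fin.sum_univ_two, Matrix.cons_val_zero, Matrix.cons_val_one, hH z hz,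
      (hasFDerivAt_momentum (0 : Fin 2) z).fderiv] at hg
    have h0 : g 0 = 0 := by
      have := congrArg (fun f => f ((0, Pi.single 1 1) : Phase 2)) hg
      simpa [← derivP.eq_def, hne] using this
    have h1 : g 1 = 0 := by
      have := congrArg (fun f => f ((0, Pi.single 0 1) : Phase 2)) hg
      simpa [h0] using this
    exact Fin.forall_fin_two.2 ⟨h0, h1⟩
  intro z hz
  by_cases hne : derivP (cyclicHamiltonian a c S) 1 z = 0
  swap
  · exact subset_closure ⟨hz, key z hz hne⟩
  have hcont : Continuous fun t : ℝ => z + t • ((0, Pi.single 1 1) : Phase 2) := by fun_prop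
  have hlim : Filter.Tendsto (fun t : ℝ => z + t • ((0, Pi.single 1 1) : Phase 2))
      (nhdsWithin 0 {0}ᶜ) (nhds z) := by
    have := hcont.tendsto 0
    rw [zero_smul, add_zero] at this
    exact this.mono_left nhdsWithin_le_nhds
  refine mem_closure_of_tendsto hlim ?_
  filter_upwards [self_mem_nhdsWithin] with t ht
  have hmem : z + t • ((0, Pi.single 1 1) : Phase 2) ∈ phaseDomain U := by
    simpa [phaseDomain] using hz
  refine ⟨hmem, key _ hmem ?_⟩
  rw [derivP_cyclicHamiltonian ha ha0] at hne ⊢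
  have hpos : 0 < c ^ 2 / a (z.1 1) ^ 2 + 1 / S ^ 2 := by positivity
  have hval : -c * ((z + t • ((0, Pi.single 1 1) : Phase 2)).2 0 -
        c * (z + t • ((0, Pi.single 1 1) : Phase 2)).2 1) /
        a ((z + t • ((0, Pi.single 1 1) : Phase 2)).1 1) ^ 2 +
        (z + t • ((0, Pi.single 1 1) : Phase 2)).2 1 / S ^ 2 =
      t * (c ^ 2 / a (z.1 1) ^ 2 + 1 / S ^ 2) := by
    rw [← sub_eq_zero, ← hne]
    simp
    ring
  rw [hval]
  exact mul_ne_zero ht hpos.ne'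

end CyclicHamiltonian

theorem theorem1 (M : SpaceForm) (I : Set ℝ) (hI_open : IsOpen I) (hI_conn : IsPreconnected I)
    (hI_ne : I.Nonempty) (γ N B : ℝ → M.Ambient) (k₁ k₂ : ℝ → ℝ)
    (hγ : M.IsFrenetCurve I γ N B k₁ k₂) (hsimple : M.IsSimpleCurve I γ)
    (hk₁ : ∃ c : ℝ, ∀ s ∈ I, k₁ s = c) (hk₂ : ∃ c : ℝ, ∀ s ∈ I, k₂ s = c)
    (ρ₀ : ℝ) (hρ₀ : 0 < ρ₀) (htube : M.IsWellDefinedTube I γ N B ρ₀) :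
    (∀ q ∈ tubeDomain I, ∀ q' ∈ tubeDomain I, q 1 = q' 1 →
      M.lineElement (M.tube γ N B ρ₀) q = M.lineElement (M.tube γ N B ρ₀) q') ∧
    IsSmoothPhaseFunction (M.tube γ N B ρ₀) (tubeDomain I) (fun z : Phase 2 => z.2 0) ∧
    IsFirstIntegral (tubeDomain I) (M.geodesicHamiltonian (M.tube γ N B ρ₀))
      (fun z : Phase 2 => z.2 0) ∧
    IsLiouvilleIntegrable (M.tube γ N B ρ₀) (tubeDomain I)
      (M.geodesicHamiltonian (M.tube γ N B ρ₀)) := by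
  obtain ⟨c₁, hc₁⟩ := hk₁
  obtain ⟨c₂, hc₂⟩ := hk₂
  obtain ⟨himm, hself⟩ := htube
  have hρ := hρ₀.ne'
  obtain ⟨s₀, hs₀⟩ := hI_ne
  set β := M.tube γ N B ρ₀ with hβ
  set H := M.geodesicHamiltonian β with hH
  set a : ℝ → ℝ := M.tubeStretch c₁ ρ₀ with ha_def
  have hne : ∀ q ∈ tubeDomain I, M.sn ρ₀ ≠ 0 ∧ a (q 1) ≠ 0 := fun q hq => by
    have := hγ.ne_zero_of_linearIndependent hI_open hρ hq (himm q hq)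
    rwa [hc₁ _ hq] at this
  have ha0 : ∀ t, a t ≠ 0 := fun t => (hne ![s₀, t] hs₀).2
  have hS : M.sn ρ₀ ≠ 0 := (hne ![s₀, 0] hs₀).1
  have ha : ContDiff ℝ ∞ a := contDiff_const.sub (contDiff_const.mul Real.contDiff_cos)
  have hopen := isOpen_phaseDomain (SpaceForm.isOpen_tubeDomain hI_open)
  have hHE : Set.EqOn H (cyclicHamiltonian a c₂ (M.sn ρ₀)) (phaseDomain (tubeDomain I)) :=
    fun z hz => by
      rw [hH, hγ.geodesicHamiltonian_tube hI_open hρ hz (himm _ hz), hc₁ _ hz, hc₂ _ hz]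
      rfl
  have hHd : ∀ z ∈ phaseDomain (tubeDomain I),
      fderiv ℝ H z = fderiv ℝ (cyclicHamiltonian a c₂ (M.sn ρ₀)) z := fun z hz =>
    (Filter.eventuallyEq_of_mem (hopen.mem_nhds hz) hHE).fderiv_eq
  have hHsmooth : ContDiffOn ℝ ∞ H (phaseDomain (tubeDomain I)) :=
    (contDiff_cyclicHamiltonian ha ha0).contDiffOn.congr hHE
  -- Parameters of the same covector have the same coordinate frame and the same momenta.
  have hsame : ∀ z ∈ phaseDomain (tubeDomain I), ∀ z' ∈ phaseDomain (tubeDomain I),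
      SameCovector β z z' → (∀ i, coordVector β i z.1 = coordVector β i z'.1) ∧ z.2 = z'.2 := by
    rintro z hz z' hz' ⟨hp, ξ, h1, h2⟩
    obtain ⟨e1, e2⟩ := hself _ hz _ hz' hp
    rw [SpaceForm.normalVector_eq, SpaceForm.normalVector_eq] at e2
    have hc := hγ.coordVector_tube_eq hI_open hI_conn hsimple hc₁ hc₂ hρ hz hz' e1
      (smul_right_injective _ hρ e2)
    exact ⟨hc, funext fun i => by rw [h1, h2, hc]⟩
  have hp_smooth : IsSmoothPhaseFunction β (tubeDomain I) (fun z : Phase 2 => z.2 0) :=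
    ⟨((contDiff_apply ℝ ℝ (0 : Fin 2)).comp contDiff_snd).contDiffOn,
      fun z hz z' hz' hzz => congrFun (hsame z hz z' hz' hzz).2 0⟩
  have hH_smooth : IsSmoothPhaseFunction β (tubeDomain I) H := by
    refine ⟨hHsmooth, fun z hz z' hz' hzz => ?_⟩
    obtain ⟨hc, hp⟩ := hsame z hz z' hz' hzz
    have : M.lineElement β z.1 = M.lineElement β z'.1 := by
      ext i j
      simp only [SpaceForm.lineElement, Matrix.of_apply, hc]
    simp only [hH, SpaceForm.geodesicHamiltonian, this, hp]
  have hbr : ∀ z ∈ phaseDomain (tubeDomain I), poisson H (fun z : Phase 2 => z.2 0) z = 0 :=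
    fun z hz => by
      rw [poisson_momentum, derivQ, hHd z hz]
      exact derivQ_cyclicHamiltonian ha ha0 z
  have hbr' : ∀ z ∈ phaseDomain (tubeDomain I), poisson (fun z : Phase 2 => z.2 0) H z = 0 :=
    fun z hz => by rw [poisson_comm, hbr z hz, neg_zero]
  have hp_int : IsFirstIntegral (tubeDomain I) H (fun z : Phase 2 => z.2 0) :=
    isFirstIntegral_of_poisson_eq_zero (fun z _ => (hasFDerivAt_momentum 0 z).differentiableAt) hbr'
  have hH_int : IsFirstIntegral (tubeDomain I) H H :=
    isFirstIntegral_of_poisson_eq_zero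
      (fun z hz => (hHsmooth.differentiableOn (by simp)).differentiableAt (hopen.mem_nhds hz))
      fun z _ => poisson_self H z
  refine ⟨fun q hq q' hq' hqq => ?_, hp_smooth, hp_int, hH_smooth,
    ![H, fun z => z.2 0], ?_, ?_, ?_, functionallyIndependent_cyclicHamiltonian ha ha0 hS hHd⟩
  · rw [hγ.lineElement_tube hI_open hρ hq, hγ.lineElement_tube hI_open hρ hq', hc₁ _ hq,
      hc₁ _ hq', hc₂ _ hq, hc₂ _ hq', hqq]
  · exact Fin.forall_fin_two.2 ⟨hH_smooth, hp_smooth⟩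
  · exact Fin.forall_fin_two.2 ⟨hH_int, hp_int⟩
  · exact Fin.forall_fin_two.2 ⟨Fin.forall_fin_two.2 ⟨fun z _ => poisson_self H z, hbr⟩,
      Fin.forall_fin_two.2 ⟨hbr', fun z _ => poisson_self _ z⟩⟩

end
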